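/- Let $p$ be a prime and let $k>1$ and $n>1$ be natural numbers. For $m>1$ write $\mathbb{L}_m=(\mathbb{Z}/m\mathbb{Z})[X,X^{-1}]$. A linear cellular automaton (LCA) over $(\mathbb{Z}/m\mathbb{Z})^n$ is a map $\mathcal{F}$ of $((\mathbb{Z}/m\mathbb{Z})^n)^{\mathbb{Z}}$ to itself of the form $\mathcal{F}(c)_i=\sum_{j=-r}^{r}A_j c_{i+j}$ with $r\in\mathbb{N}$ and matrices $A_{-r},\dots,A_r\in(\mathbb{Z}/m\mathbb{Z})^{n\times n}$; its associated matrix is $\sum_{j=-r}^{r}A_jX^{-j}\in\mathbb{L}_m^{n\times n}$. Let $d(c,c')=2^{-\min\{|j|\,:\,c_j\neq c'_j\}}$ for $c\ne c'$ and $d(c,c)=0$. The map $\mathcal{F}$ is positively expansive if there is $\varepsilon>0$ such that for all configurations $c\neq c'$ there is $\ell\in\mathbb{N}$ with $d(\mathcal{F}^{\ell}(c),\mathcal{F}^{\ell}(c'))\ge\varepsilon$. For $0\neq\alpha\in\mathbb{L}_m$ let $\deg^+(\alpha)$ and $\deg^-(\alpha)$ be the maximum and the minimum of the degrees of the monomials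 of $\alpha$, and let $\deg^+(0)=-\infty$, $\deg^-(0)=+\infty$. A matrix in $\mathbb{L}_m^{n\times n}$ with characteristic polynomial $\alpha_0+\alpha_1t+\dots+\alpha_{n-1}t^{n-1}+t^n$ is expansive if $\alpha_0\neq0$, $\deg^+(\alpha_0)>0$, $\deg^-(\alpha_0)<0$, and $\deg^+(\alpha_0)>\deg^+(\alpha_i)$ and $\deg^-(\alpha_0)<\deg^-(\alpha_i)$ for every $i\in\{1,\dots,n-1\}$. Let $\mathcal{G}$ be any LCA over $(\mathbb{Z}/p^k\mathbb{Z})^n$ with associated matrix $B\in\mathbb{L}_{p^k}^{n\times n}$, and let $A=(B\bmod p)\in\mathbb{L}_p^{n\times n}$ be obtained by reducing all coefficients modulo $p$. Then $\mathcal{G}$ is positively expansive if and only if the LCA $\mathcal{F}$ over $(\mathbb{Z}/p\mathbb{Z})^n$ having $A$ as associated matrix is positively expansive. Equivalently, $\mathcal{G}$ is positively expansive if and only if the matrix $A=B\bmod p$ is expansive. -/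

import Mathlib

namespace LCA

noncomputable section

/-- The standard (Tychonoff) distance on the configuration space `S^ℤ`:
`d(c, c') = 2^(-min {|j| : c_j ≠ c'_j})` if `c ≠ c'`, and `0` otherwise. -/
def tychonoffDist {S : Type*} (c c' : ℤ → S) : ℝ :=
  open Classical in
  if c = c' then 0
  else (1 / 2 : ℝ) ^ sInf {k : ℕ | ∃ j : ℤ, j.natAbs = k ∧ c j ≠ c' j}

/-- A self-map `F` of the configuration space `S^ℤ` is positively expansive if there is a constant
`ε > 0` such that the orbits of any two distinct configurations are, at some time, at distance at
least `ε`. -/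
def PositivelyExpansive {S : Type*} (F : (ℤ → S) → (ℤ → S)) : Prop :=
  ∃ ε : ℝ, 0 < ε ∧ ∀ c c' : ℤ → S, c ≠ c' → ∃ l : ℕ, ε ≤ tychonoffDist (F^[l] c) (F^[l] c')

/-- The global rule of the one-dimensional cellular automaton with alphabet `S` and local rule `f`
of radius `r`: `F(c)_i = f(c_{i-r}, …, c_{i+r})`. -/
def globalRule {S : Type*} (r : ℕ) (f : (Set.Icc (-(r : ℤ)) (r : ℤ) → S) → S) :
    (ℤ → S) → (ℤ → S) :=
  fun c i => f (fun j => c (i + j))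

/-- The data of a one-dimensional linear cellular automaton over `(ℤ/mℤ)^n`: a radius `r` and
matrices `A_{-r}, …, A_r` over `ℤ/mℤ`. -/
structure LinearCA (m n : ℕ) where
  /-- The radius of the local rule. -/
  radius : ℕ
  /-- The matrices defining the local rule. -/
  coeff : Set.Icc (-(radius : ℤ)) (radius : ℤ) → Matrix (Fin n) (Fin n) (ZMod m)

namespace LinearCA

variable {m n : ℕ}

/-- The linear local rule `f(x_{-r}, …, x_r) = ∑_{j=-r}^{r} A_j x_j`. -/
def localRule (F : LinearCA m n) :
    (Set.Icc (-(F.radius : ℤ)) (F.radius : ℤ) → (Fin n → ZMod m)) → (Fin n → ZMod m) :=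
  fun x => ∑ j, (F.coeff j).mulVec (x j)

/-- The linear cellular automaton itself, as a map `((ℤ/mℤ)^n)^ℤ → ((ℤ/mℤ)^n)^ℤ`. -/
def toFun (F : LinearCA m n) : (ℤ → (Fin n → ZMod m)) → (ℤ → (Fin n → ZMod m)) :=
  globalRule F.radius F.localRule

/-- The matrix `∑_{j=-r}^{r} A_j X^{-j}` associated with the linear cellular automaton, as an
`n × n` matrix of Laurent polynomials over `ℤ/mℤ`. -/
def matrix (F : LinearCA m n) : Matrix (Fin n) (Fin n) (LaurentPolynomial (ZMod m)) :=
  ∑ j, (F.coeff j).map (fun a => LaurentPolynomial.C a * LaurentPolynomial.T (-(j : ℤ)))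

end LinearCA

/-- Reduction modulo `d`, for `d ∣ m`, of a matrix of Laurent polynomials over `ℤ/mℤ`: all the
coefficients of all the entries are reduced modulo `d`. -/
def reduceMatrix {m d n : ℕ} (h : d ∣ m) (B : Matrix (Fin n) (Fin n) (LaurentPolynomial (ZMod m))) :
    Matrix (Fin n) (Fin n) (LaurentPolynomial (ZMod d)) :=
  B.map (AddMonoidAlgebra.mapRingHom ℤ (ZMod.castHom h (ZMod d)))

/-- Reducing the matrices of the local rule of a linear cellular automaton. -/
def LinearCA.reduce {m d n : ℕ} (h : d ∣ m) (G : LinearCA m n) : LinearCA d n where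
  radius := G.radius
  coeff := fun j => (G.coeff j).map (ZMod.castHom h (ZMod d))

/-- There is always a linear cellular automaton whose associated matrix is the reduction of the
matrix associated with a given one. -/
theorem LinearCA.matrix_reduce {m d n : ℕ} (h : d ∣ m) (G : LinearCA m n) :
    (G.reduce h).matrix = reduceMatrix h G.matrix := by
  ext1 a b
  simp only [LinearCA.matrix, reduceMatrix, LinearCA.reduce, Matrix.sum_apply, Matrix.map_apply,
    map_sum, map_mul]
  refine Finset.sum_congr rfl fun j _ => ?_
  rw [← map_mul, ← LaurentPolynomial.single_eq_C_mul_T, ← LaurentPolynomial.single_eq_C_mul_T]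
  exact (AddMonoidAlgebra.mapRingHom_single _ _ _).symm

/-- The positive degree of a Laurent polynomial: the maximum of the degrees of its monomials, and
`-∞` for the zero polynomial. -/
def posDegree {R : Type*} [Semiring R] (α : LaurentPolynomial R) : WithBot ℤ :=
  α.coeff.support.max

/-- The negative degree of a Laurent polynomial: the minimum of the degrees of its monomials, and
`+∞` for the zero polynomial. -/
def negDegree {R : Type*} [Semiring R] (α : LaurentPolynomial R) : WithTop ℤ :=
  α.coeff.support.min

/-- A monic polynomial `π(t) = α_0 + α_1 t + ⋯ + α_{n-1} t^{n-1} + t^n` whose coefficients are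
Laurent polynomials is expansive if `α_0 ≠ 0`, `deg⁺ α_0 > 0`, `deg⁻ α_0 < 0`, and, for every
`i = 1, …, n - 1`, `deg⁺ α_0 > deg⁺ α_i` and `deg⁻ α_0 < deg⁻ α_i`. -/
def ExpansivePolynomial {R : Type*} [CommRing R] (π : Polynomial (LaurentPolynomial R)) : Prop :=
  π.Monic ∧ π.coeff 0 ≠ 0 ∧
    (0 < posDegree (π.coeff 0) ∧
      ∀ i : ℕ, 1 ≤ i → i < π.natDegree → posDegree (π.coeff i) < posDegree (π.coeff 0)) ∧
    (negDegree (π.coeff 0) < 0 ∧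
      ∀ i : ℕ, 1 ≤ i → i < π.natDegree → negDegree (π.coeff 0) < negDegree (π.coeff i))

/-- A square matrix of Laurent polynomials is expansive if its characteristic polynomial
`det (t I - A)` is. -/
def ExpansiveMatrix {R : Type*} [CommRing R] {n : ℕ}
    (A : Matrix (Fin n) (Fin n) (LaurentPolynomial R)) : Prop :=
  ExpansivePolynomial A.charpoly

end

end LCA

/-!
Write `q = p ^ k`. The argument has two independent halves.

*Reduction modulo `p`.* Since the maps are additive, positive expansivity says that some window
`[-N, N]` detects every nonzero configuration `c`: some iterate of `c` is nonzero inside the window.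
Multiplication by `p ^ (k - 1)` identifies the configurations over `ℤ/pℤ` with the configurations
over `ℤ/qℤ` killed by `p`, and the automaton acts on the latter as its reduction. Every nonzero
configuration has a nonzero multiple `p ^ s c` killed by `p`, so the automaton and its reduction
are detected by the same windows (`LinearCA.positivelyExpansive_reduce_iff`).

*The field case.* Let `K = ℤ/pℤ` and let `t` act on `M = K[T;T⁻¹]ⁿ` through the transpose of the
associated matrix. Configurations are the linear forms on `M`, and the automaton is dual to `t`
(`configOf`, `toFun_configOf`). Hence a window detects all configurations exactly when the shifts
`T ^ j` of the standard basis vectors, with `j` in the window, generate `M` over `K[t]`.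

If `M` is finitely generated over `K[t]`, then `T` and `T⁻¹` act integrally on it, so that a
polynomial `f(t, T)` which is monic in `T` annihilates `M`. From `f(t) I = (t I - A) Q` the
characteristic polynomial `χ` of the matrix divides a power of `f`
(`charpoly_dvd_pow_card_of_aeval_eq_zero`). As `K[t]` is a domain, the leading coefficient of `χ`
in `T` is a unit of `K[t]`, that is, a nonzero constant (`HasConstTop.of_dvd`). So the highest power
of `T` in `χ` occurs in the coefficient `α_0` only. The same holds for `T⁻¹`, and together these
two properties are the expansivity of `χ` (`expansivePolynomial_iff`). Conversely, if `χ` has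
these properties, then Cayley–Hamilton expresses `T ^ (j + 1) v` and `T ^ (-j - 1) v` over `K[t]`
through the `T ^ i v` with `|i| ≤ j`, as soon as `j` is large (`exists_window_T_smul_mem`).
-/

namespace LCA

open Polynomial

open scoped LaurentPolynomial

/-! ### Polynomials annihilating a matrix -/

section Annihilating

variable {R : Type*} [CommRing R] {n : Type*} [Fintype n] [DecidableEq n]

/-- Division of `f(t) I` by `t I - B` leaves the remainder `f(B)`. -/
theorem exists_scalar_eq_charmatrix_mul_add (B : Matrix n n R) (f : R[X]) :
    ∃ Q : Matrix n n R[X],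
      Matrix.scalar n f = B.charmatrix * Q + (Polynomial.C.mapMatrix (aeval B f)) := by
  induction f using Polynomial.induction_on with
  | C a =>
    refine ⟨0, ?_⟩
    ext i j
    by_cases h : i = j <;> simp [Matrix.algebraMap_matrix_apply, h]
  | add p q hp hq =>
    obtain ⟨P, hP⟩ := hp
    obtain ⟨Q, hQ⟩ := hq
    exact ⟨P + Q, by rw [map_add, hP, hQ, map_add, map_add, mul_add]; abel⟩
  | monomial m a ih =>
    obtain ⟨Q, hQ⟩ := ih
    refine ⟨Q * Matrix.scalar n X + Polynomial.C.mapMatrix (aeval B (C a * X ^ m)), ?_⟩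
    have hcomm : B * aeval B (C a * X ^ m) = aeval B (C a * X ^ m) * B := by
      have := congrArg (aeval B) (mul_comm X (C a * X ^ m))
      rwa [map_mul (aeval B) X, map_mul (aeval B) _ X, aeval_X] at this
    have hsucc : aeval B (C a * X ^ (m + 1)) = B * aeval B (C a * X ^ m) := by
      rw [pow_succ, ← mul_assoc, map_mul, aeval_X, hcomm]
    have hscalar := (Matrix.scalar_commute (X : R[X]) (fun _ => mul_comm _ _)
      (Polynomial.C.mapMatrix (aeval B (C a * X ^ m)))).eq
    rw [hsucc, pow_succ, ← mul_assoc, map_mul, hQ, map_mul Polynomial.C.mapMatrix,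
      Matrix.charmatrix, add_mul, ← hscalar]
    noncomm_ring

/-- If `f(B) = 0` then `f(t) I` is a multiple of `t I - B`; take determinants. -/
theorem charpoly_dvd_pow_card_of_aeval_eq_zero (B : Matrix n n R) {f : R[X]}
    (hf : aeval B f = 0) : B.charpoly ∣ f ^ Fintype.card n := by
  obtain ⟨Q, hQ⟩ := exists_scalar_eq_charmatrix_mul_add B f
  rw [hf, map_zero, add_zero] at hQ
  have := congrArg Matrix.det hQ
  rw [Matrix.det_mul, Matrix.scalar_apply, Matrix.det_diagonal, Finset.prod_const,
    Finset.card_univ] at this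
  exact ⟨Q.det, this⟩

end Annihilating

/-! ### Polynomials in two variables with a constant leading coefficient in `T` -/

section ConstTop

variable {K : Type*} [Field K]

/-- A polynomial `q` in `t` with Laurent polynomial coefficients in `T` has constant top
coefficient if, viewed as a Laurent polynomial in `T` over `K[t]`, its leading coefficient, here
that of `T ^ d`, is a nonzero constant. -/
def HasConstTop (q : K[T;T⁻¹][X]) : Prop :=
  ∃ d : ℤ, (q.coeff 0).coeff d ≠ 0 ∧
    ∀ (i : ℕ) (j : ℤ), d ≤ j → (i ≠ 0 ∨ j ≠ d) → (q.coeff i).coeff j = 0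

/-- The homomorphism `K[T;T⁻¹][t] → K[t][T;T⁻¹]` exchanging the two variables. -/
noncomputable def swapVars : K[T;T⁻¹][X] →+* K[X][T;T⁻¹] :=
  eval₂RingHom (AddMonoidAlgebra.mapRingHom ℤ Polynomial.C) (LaurentPolynomial.C X)

/-- The homomorphism `K[t][Y] → K[T;T⁻¹][t]` with `Y ↦ T ^ e`. -/
noncomputable def substT (e : ℤ) : K[X][X] →+* K[T;T⁻¹][X] :=
  eval₂RingHom (mapRingHom LaurentPolynomial.C) (Polynomial.C (LaurentPolynomial.T e))

theorem coeff_coeff_swapVars (q : K[T;T⁻¹][X]) (i : ℕ) (j : ℤ) :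
    ((swapVars q).coeff j).coeff i = (q.coeff i).coeff j := by
  induction q using Polynomial.induction_on' with
  | add p q hp hq => simp [hp, hq]
  | monomial m f =>
    have : swapVars (monomial m f) =
        (X ^ m : K[X]) • AddMonoidAlgebra.mapRingHom ℤ Polynomial.C f := by
      rw [LaurentPolynomial.smul_eq_C_mul, map_pow, mul_comm]
      simp [swapVars]
    rw [this]
    rw [AddMonoidAlgebra.coeff_smul, Finsupp.smul_apply, AddMonoidAlgebra.coeff_mapRingHom,
      smul_eq_mul, mul_comm, Polynomial.coeff_C_mul_X_pow, Polynomial.coeff_monomial]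
    by_cases h : i = m
    · simp [h]
    · simp [h, Ne.symm h]

theorem swapVars_substT_one (p : K[X][X]) : swapVars (substT 1 p) = Polynomial.toLaurent p := by
  have : (swapVars.comp (substT 1)) = (Polynomial.toLaurent : K[X][X] →+* K[X][T;T⁻¹]) := by
    ext
    · simp only [swapVars, substT, RingHom.comp_apply, coe_eval₂RingHom, eval₂_C, coe_mapRingHom,
        map_C, Polynomial.toLaurent_C, ← LaurentPolynomial.single_eq_C,
        AddMonoidAlgebra.mapRingHom_single]
    · simp [swapVars, substT]
    · simp only [swapVars, substT, RingHom.comp_apply, coe_eval₂RingHom, eval₂_X, eval₂_C,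
        Polynomial.toLaurent_X, LaurentPolynomial.T, AddMonoidAlgebra.mapRingHom_single, map_one]
  exact congrArg (fun φ => φ p) this

/-- A divisor of a polynomial that is monic in `T` over the domain `K[t]` has a unit of `K[t]`,
hence a nonzero constant, as its leading coefficient in `T`. -/
theorem HasConstTop.of_dvd {q : K[T;T⁻¹][X]} {p : K[X][X]} (hp : p.Monic)
    (h : q ∣ substT 1 p) : HasConstTop q := by
  obtain ⟨r, hr⟩ := h
  have hr' := congrArg swapVars hr
  rw [swapVars_substT_one, map_mul] at hr'
  -- After multiplication by powers of `T` both factors are polynomials in `T` over `K[t]`.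
  obtain ⟨a, u, hu⟩ := LaurentPolynomial.exists_T_pow (swapVars q)
  obtain ⟨b, w, hw⟩ := LaurentPolynomial.exists_T_pow (swapVars r)
  have huw : p * X ^ (a + b) = u * w := by
    apply Polynomial.toLaurent_injective
    rw [map_mul, map_mul, hr', hu, hw, Polynomial.toLaurent_X_pow, Nat.cast_add,
      LaurentPolynomial.T_add]
    ring
  have hunit : IsUnit u.leadingCoeff :=
    (hp.mul (monic_X_pow (a + b))).isUnit_leadingCoeff_of_dvd ⟨w, huw⟩
  obtain ⟨c, hc, hcu⟩ := Polynomial.isUnit_iff.mp hunit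
  have hcoeff (i : ℕ) (m : ℕ) : (q.coeff i).coeff (m - a : ℤ) = (u.coeff m).coeff i := by
    rw [← coeff_coeff_swapVars]
    have h1 : swapVars q = Polynomial.toLaurent u * LaurentPolynomial.T (-a : ℤ) := by
      rw [hu, LaurentPolynomial.mul_T_assoc, add_neg_cancel, LaurentPolynomial.T_zero, mul_one]
    rw [h1, LaurentPolynomial.T, AddMonoidAlgebra.coeff_mul_single_apply, mul_one, neg_neg,
      sub_add_cancel, Polynomial.toLaurent_apply, AddMonoidAlgebra.coeff_mapDomain,
      Finsupp.mapDomain_apply Nat.cast_injective]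
    rfl
  refine ⟨u.natDegree - a, ?_, ?_⟩
  · rw [hcoeff, coeff_natDegree, ← hcu, coeff_C_zero]
    exact hc.ne_zero
  · intro i j hj hij
    obtain ⟨m, rfl⟩ : ∃ m : ℕ, j = m - a := ⟨(j + a).toNat, by lia⟩
    rw [hcoeff]
    rcases (show u.natDegree ≤ m by lia).eq_or_lt with h | h
    · have hi : i ≠ 0 := by
        rcases hij with hi | hi
        · exact hi
        · exact absurd (by rw [h]) hi
      rw [← h, coeff_natDegree, ← hcu, coeff_C_of_ne_zero hi]
    · rw [coeff_eq_zero_of_natDegree_lt h, coeff_zero]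

/-- Inverting `T` reduces statements about `T⁻¹` to statements about `T`. -/
theorem map_invert_substT (p : K[X][X]) :
    (substT (-1) p).map (LaurentPolynomial.invert : K[T;T⁻¹] ≃ₐ[K] _).toRingHom = substT 1 p := by
  have : (mapRingHom (LaurentPolynomial.invert : K[T;T⁻¹] ≃ₐ[K] _).toRingHom).comp (substT (-1)) =
      (substT 1 : K[X][X] →+* K[T;T⁻¹][X]) := by
    ext
    · simp [substT]
    · simp [substT]
    · simp [substT]
  exact congrArg (fun φ => φ p) this

/-! ### Expansive polynomials -/

theorem posDegree_lt_posDegree_iff {R : Type*} [Semiring R] {α β : R[T;T⁻¹]} :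
    posDegree α < posDegree β ↔ ∃ d, β.coeff d ≠ 0 ∧ ∀ j, d ≤ j → α.coeff j = 0 := by
  constructor
  · intro h
    obtain ⟨d, hd⟩ := WithBot.ne_bot_iff_exists.mp (ne_bot_of_gt h)
    refine ⟨d, Finsupp.mem_support_iff.mp (Finset.mem_of_max hd.symm), fun j hj => ?_⟩
    by_contra h0
    have h1 : (j : WithBot ℤ) ≤ posDegree α := Finset.le_max (Finsupp.mem_support_iff.mpr h0)
    rw [← hd] at h
    exact absurd (WithBot.coe_lt_coe.mp (h1.trans_lt h)) (not_lt.mpr hj)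
  · rintro ⟨d, hd, h⟩
    have h1 : (d : WithBot ℤ) ≤ posDegree β := Finset.le_max (Finsupp.mem_support_iff.mpr hd)
    refine lt_of_lt_of_le ?_ h1
    rw [posDegree, Finset.max_eq_sup_withBot, Finset.sup_lt_iff (WithBot.bot_lt_coe d)]
    intro j hj
    refine WithBot.coe_lt_coe.mpr (lt_of_not_ge fun hdj => ?_)
    exact Finsupp.mem_support_iff.mp hj (h j hdj)

theorem negDegree_lt_negDegree_iff {R : Type*} [Semiring R] {α β : R[T;T⁻¹]} :
    negDegree β < negDegree α ↔ ∃ d, β.coeff d ≠ 0 ∧ ∀ j, j ≤ d → α.coeff j = 0 := by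
  constructor
  · intro h
    obtain ⟨d, hd⟩ := WithTop.ne_top_iff_exists.mp (ne_top_of_lt h)
    refine ⟨d, Finsupp.mem_support_iff.mp (Finset.mem_of_min hd.symm), fun j hj => ?_⟩
    by_contra h0
    have h1 : negDegree α ≤ (j : WithTop ℤ) := Finset.min_le (Finsupp.mem_support_iff.mpr h0)
    rw [← hd] at h
    exact absurd (WithTop.coe_lt_coe.mp (h.trans_le h1)) (not_lt.mpr hj)
  · rintro ⟨d, hd, h⟩
    have h1 : negDegree β ≤ (d : WithTop ℤ) := Finset.min_le (Finsupp.mem_support_iff.mpr hd)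
    refine lt_of_le_of_lt h1 ?_
    rw [negDegree, Finset.min_eq_inf_withTop, Finset.lt_inf_iff (WithTop.coe_lt_top d)]
    intro j hj
    refine WithTop.coe_lt_coe.mpr (lt_of_not_ge fun hdj => ?_)
    exact Finsupp.mem_support_iff.mp hj (h j hdj)

theorem negDegree_lt_negDegree_iff_invert {R : Type*} [CommSemiring R] {α β : R[T;T⁻¹]} :
    negDegree β < negDegree α ↔
      posDegree (LaurentPolynomial.invert α) < posDegree (LaurentPolynomial.invert β) := by
  rw [negDegree_lt_negDegree_iff, posDegree_lt_posDegree_iff, (neg_surjective (G := ℤ)).exists]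
  simp only [LaurentPolynomial.invert_apply]
  refine exists_congr fun d => and_congr_right fun _ => ?_
  rw [(neg_surjective (G := ℤ)).forall]
  simp

theorem posDegree_one {R : Type*} [Semiring R] [Nontrivial R] :
    posDegree (1 : R[T;T⁻¹]) = 0 := by
  rw [posDegree, AddMonoidAlgebra.support_coeff_one]
  exact Finset.max_singleton

theorem negDegree_one {R : Type*} [Semiring R] [Nontrivial R] :
    negDegree (1 : R[T;T⁻¹]) = 0 := by
  rw [negDegree, AddMonoidAlgebra.support_coeff_one]
  exact Finset.min_singleton

/-- The condition on positive degrees in the definition of an expansive polynomial. The condition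
`0 < deg⁺ α_0` is the instance `i = natDegree` of the condition `deg⁺ α_i < deg⁺ α_0`. -/
theorem hasConstTop_iff {q : K[T;T⁻¹][X]} (hq : q.Monic) (hdeg : q.natDegree ≠ 0) :
    HasConstTop q ↔ posDegree (1 : K[T;T⁻¹]) < posDegree (q.coeff 0) ∧
      ∀ i : ℕ, 1 ≤ i → i < q.natDegree → posDegree (q.coeff i) < posDegree (q.coeff 0) := by
  constructor
  · rintro ⟨d, hd, h⟩
    have key (i : ℕ) (hi : i ≠ 0) : posDegree (q.coeff i) < posDegree (q.coeff 0) :=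
      posDegree_lt_posDegree_iff.mpr ⟨d, hd, fun j hj => h i j hj (Or.inl hi)⟩
    refine ⟨?_, fun i hi _ => key i (by lia)⟩
    have := key _ hdeg
    rwa [coeff_natDegree, hq] at this
  · rintro ⟨h1, h2⟩
    have key (i : ℕ) (hi : i ≠ 0) : posDegree (q.coeff i) < posDegree (q.coeff 0) := by
      rcases lt_trichotomy i q.natDegree with h | h | h
      · exact h2 i (by lia) h
      · rwa [h, coeff_natDegree, hq]
      · rw [coeff_eq_zero_of_natDegree_lt h]
        exact lt_of_le_of_lt (by simp [posDegree]) h1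
    obtain ⟨d, hd⟩ := WithBot.ne_bot_iff_exists.mp (ne_bot_of_gt h1)
    have hzero (i : ℕ) (j : ℤ) (hj : posDegree (q.coeff i) < j) : (q.coeff i).coeff j = 0 := by
      by_contra h0
      exact absurd (Finset.le_max (Finsupp.mem_support_iff.mpr h0)) (not_le.mpr hj)
    refine ⟨d, Finsupp.mem_support_iff.mp (Finset.mem_of_max hd.symm), fun i j hj hij => ?_⟩
    apply hzero
    by_cases hi : i = 0
    · subst hi
      rw [← hd]
      exact WithBot.coe_lt_coe.mpr (lt_of_le_of_ne hj (by tauto))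
    · refine (key i hi).trans_le ?_
      rw [← hd]
      exact WithBot.coe_le_coe.mpr hj

theorem expansivePolynomial_iff {q : K[T;T⁻¹][X]} (hq : q.Monic) (hdeg : q.natDegree ≠ 0) :
    ExpansivePolynomial q ↔ HasConstTop q ∧
      HasConstTop (q.map (LaurentPolynomial.invert : K[T;T⁻¹] ≃ₐ[K] _).toRingHom) := by
  have hdeg' : (q.map (LaurentPolynomial.invert : K[T;T⁻¹] ≃ₐ[K] _).toRingHom).natDegree =
      q.natDegree := hq.natDegree_map _
  rw [hasConstTop_iff hq hdeg, hasConstTop_iff (hq.map _) (by rwa [hdeg']), hdeg',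
    ExpansivePolynomial, posDegree_one]
  have h1 (i : ℕ) : (q.map (LaurentPolynomial.invert : K[T;T⁻¹] ≃ₐ[K] _).toRingHom).coeff i =
      LaurentPolynomial.invert (q.coeff i) := by
    rw [coeff_map]; rfl
  have h2 : negDegree (q.coeff 0) < 0 ↔
      0 < posDegree (LaurentPolynomial.invert (q.coeff 0)) := by
    rw [← negDegree_one (R := K), negDegree_lt_negDegree_iff_invert, map_one, posDegree_one]
  simp only [h1, negDegree_lt_negDegree_iff_invert, h2]
  refine ⟨fun h => h.2.2, fun h => ⟨hq, fun h0 => ?_, h⟩⟩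
  have := h.1.1
  rw [h0] at this
  simp [posDegree] at this

end ConstTop

/-! ### Laurent vectors as a module over the polynomials in a matrix -/

section LaurentVectors

variable {K : Type*} [Field K] {ι : Type*}

/-- A subspace contains `f v` as soon as it contains `T ^ m v` for all exponents `m` of `f`. -/
theorem laurent_smul_mem (S : Submodule K (ι → K[T;T⁻¹])) (v : ι → K[T;T⁻¹]) (f : K[T;T⁻¹])
    (h : ∀ m : ℤ, f.coeff m ≠ 0 → (LaurentPolynomial.T m : K[T;T⁻¹]) • v ∈ S) : f • v ∈ S := by
  rw [← AddMonoidAlgebra.sum_coeff_single f, Finsupp.sum, Finset.sum_smul]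
  refine S.sum_mem fun m hm => ?_
  rw [LaurentPolynomial.single_eq_C_mul_T, ← LaurentPolynomial.smul_eq_C_mul, smul_assoc]
  exact S.smul_mem _ (h m (Finsupp.mem_support_iff.mp hm))

variable [Fintype ι]

/-- The `K`-linear endomorphism `v ↦ A v` of the space of vectors of Laurent polynomials. -/
noncomputable def matrixEnd (A : Matrix ι ι K[T;T⁻¹]) : Module.End K (ι → K[T;T⁻¹]) :=
  A.mulVecLin.restrictScalars K

theorem matrixEnd_apply (A : Matrix ι ι K[T;T⁻¹]) (v : ι → K[T;T⁻¹]) :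
    matrixEnd A v = A.mulVec v := rfl

/-- Multiplication by `T ^ e` as an endomorphism of the `K[t]`-module of vectors of Laurent
polynomials on which `t` acts as the matrix `A`. -/
noncomputable def shiftEnd (A : Matrix ι ι K[T;T⁻¹]) (e : ℤ) :
    Module.End K[X] (Module.AEval' (matrixEnd A)) :=
  LinearMap.ofAEval (matrixEnd A)
    ((Module.AEval'.of (matrixEnd A)).toLinearMap ∘ₗ
      (LinearMap.lsmul K[T;T⁻¹] (ι → K[T;T⁻¹]) (LaurentPolynomial.T e)).restrictScalars K)
    (fun m => by
      simp [Module.AEval'.X_smul_of, matrixEnd_apply, Matrix.mulVec_smul])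

theorem shiftEnd_of (A : Matrix ι ι K[T;T⁻¹]) (e : ℤ) (v : ι → K[T;T⁻¹]) :
    shiftEnd A e (Module.AEval'.of (matrixEnd A) v) =
      Module.AEval'.of (matrixEnd A) ((LaurentPolynomial.T e : K[T;T⁻¹]) • v) := by
  simp [shiftEnd, LinearMap.ofAEval]

theorem shiftEnd_pow_of (A : Matrix ι ι K[T;T⁻¹]) (e : ℤ) (l : ℕ) (v : ι → K[T;T⁻¹]) :
    (shiftEnd A e ^ l) (Module.AEval'.of (matrixEnd A) v) =
      Module.AEval'.of (matrixEnd A) ((LaurentPolynomial.T e ^ l : K[T;T⁻¹]) • v) := by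
  induction l with
  | zero => simp
  | succ l ih => rw [pow_succ', pow_succ', Module.End.mul_apply, ih, shiftEnd_of, mul_smul]

variable [DecidableEq ι]

theorem matrixEnd_pow_apply (A : Matrix ι ι K[T;T⁻¹]) (l : ℕ) (v : ι → K[T;T⁻¹]) :
    (matrixEnd A ^ l) v = (A ^ l).mulVec v := by
  induction l with
  | zero => simp
  | succ l ih => rw [pow_succ', pow_succ', Module.End.mul_apply, ih, matrixEnd_apply,
      Matrix.mulVec_mulVec]

theorem aeval_matrixEnd_apply (A : Matrix ι ι K[T;T⁻¹]) (f : K[X]) (v : ι → K[T;T⁻¹]) :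
    aeval (matrixEnd A) f v = (aeval A (f.map LaurentPolynomial.C)).mulVec v := by
  induction f using Polynomial.induction_on' with
  | add p q hp hq => simp [hp, hq, Matrix.add_mulVec]
  | monomial m a =>
    rw [aeval_monomial, map_monomial, aeval_monomial, Module.End.mul_apply, matrixEnd_pow_apply,
      ← Matrix.mulVec_mulVec, Module.algebraMap_end_apply, Algebra.algebraMap_eq_smul_one,
      Matrix.smul_mulVec, Matrix.one_mulVec]
    ext1 i
    simp [LaurentPolynomial.smul_eq_C_mul]

theorem aeval_shiftEnd_of (A : Matrix ι ι K[T;T⁻¹]) (e : ℤ) (p : K[X][X])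
    (v : ι → K[T;T⁻¹]) :
    aeval (shiftEnd A e) p (Module.AEval'.of (matrixEnd A) v) =
      Module.AEval'.of (matrixEnd A) ((aeval A (substT e p)).mulVec v) := by
  induction p using Polynomial.induction_on' with
  | add p q hp hq => simp [hp, hq, Matrix.add_mulVec]
  | monomial m f =>
    have h : substT e (monomial m f : K[X][X]) =
        f.map LaurentPolynomial.C * Polynomial.C (LaurentPolynomial.T e ^ m) := by
      simp [substT, -LaurentPolynomial.T_pow]
    rw [h, aeval_monomial, Module.End.mul_apply, shiftEnd_pow_of, Module.algebraMap_end_apply,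
      ← Module.AEval.of_aeval_smul, Module.End.smul_def, aeval_matrixEnd_apply, map_mul, aeval_C,
      ← Matrix.mulVec_mulVec, Algebra.algebraMap_eq_smul_one, Matrix.smul_mulVec,
      Matrix.one_mulVec]

/-- If the vectors of Laurent polynomials are finitely generated over `K[t]`, then `T ^ e` acts
integrally on them. -/
theorem exists_monic_aeval_substT_eq_zero (A : Matrix ι ι K[T;T⁻¹])
    [Module.Finite K[X] (Module.AEval' (matrixEnd A))] (e : ℤ) :
    ∃ p : K[X][X], p.Monic ∧ aeval A (substT e p) = 0 := by
  obtain ⟨p, hp, h⟩ := LinearMap.exists_monic_and_aeval_eq_zero K[X] (shiftEnd A e)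
  refine ⟨p, hp, Matrix.mulVec_injective (funext fun v => ?_)⟩
  apply (Module.AEval'.of (matrixEnd A)).injective
  rw [← aeval_shiftEnd_of, h]
  simp

/-- If the vectors of Laurent polynomials are finitely generated over `K[t]`, with `t` acting as
`A`, then the integrality of `T` and `T⁻¹` forces constant coefficients at both ends of the
characteristic polynomial, as a Laurent polynomial in `T`. -/
theorem hasConstTop_charpoly_of_finite (A : Matrix ι ι K[T;T⁻¹])
    [Module.Finite K[X] (Module.AEval' (matrixEnd A))] :
    HasConstTop A.charpoly ∧
      HasConstTop (A.charpoly.map (LaurentPolynomial.invert : K[T;T⁻¹] ≃ₐ[K] _).toRingHom) := by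
  constructor
  · obtain ⟨p, hp, h⟩ := exists_monic_aeval_substT_eq_zero A 1
    refine HasConstTop.of_dvd (hp.pow (Fintype.card ι)) ?_
    rw [map_pow]
    exact charpoly_dvd_pow_card_of_aeval_eq_zero A h
  · obtain ⟨p, hp, h⟩ := exists_monic_aeval_substT_eq_zero A (-1)
    refine HasConstTop.of_dvd (hp.pow (Fintype.card ι)) ?_
    rw [← map_invert_substT, map_pow]
    exact Polynomial.map_dvd _ (charpoly_dvd_pow_card_of_aeval_eq_zero A h)

/-- A polynomial relation `q(A) = 0` in which `t ^ 0 T ^ d` has a nonzero coefficient expresses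
`T ^ d v` through the other terms. -/
theorem T_smul_mem_of_aeval_eq_zero {A : Matrix ι ι K[T;T⁻¹]} {q : K[T;T⁻¹][X]}
    (hq : aeval A q = 0) {S : Submodule K (ι → K[T;T⁻¹])} (hS : ∀ v ∈ S, matrixEnd A v ∈ S)
    {d : ℤ} (hd : (q.coeff 0).coeff d ≠ 0) (v : ι → K[T;T⁻¹])
    (h : ∀ (i : ℕ) (m : ℤ), (q.coeff i).coeff m ≠ 0 → (i ≠ 0 ∨ m ≠ d) →
      (LaurentPolynomial.T m : K[T;T⁻¹]) • v ∈ S) :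
    (LaurentPolynomial.T d : K[T;T⁻¹]) • v ∈ S := by
  have hpow (i : ℕ) (w : ι → K[T;T⁻¹]) (hw : w ∈ S) : (A ^ i).mulVec w ∈ S := by
    rw [← matrixEnd_pow_apply]
    induction i with
    | zero => simpa
    | succ i ih =>
      rw [pow_succ', Module.End.mul_apply]
      exact hS _ ih
  have hterm (i : ℕ) (hi : i ≠ 0) : (A ^ i).mulVec (q.coeff i • v) ∈ S :=
    hpow i _ (laurent_smul_mem S v _ fun m hm => h i m hm (Or.inl hi))
  have hsum : q.coeff 0 • v + ∑ i ∈ Finset.range q.natDegree,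
      (A ^ (i + 1)).mulVec (q.coeff (i + 1) • v) = 0 := by
    have := congrArg (fun M => M.mulVec v) hq
    simp only [aeval_eq_sum_range, Matrix.zero_mulVec, Matrix.sum_mulVec] at this
    rw [Finset.sum_range_succ'] at this
    simpa [Matrix.mulVec_smul, Matrix.smul_mulVec, add_comm] using this
  have h0 : q.coeff 0 • v ∈ S := by
    rw [eq_neg_of_add_eq_zero_left hsum]
    exact S.neg_mem (S.sum_mem fun i _ => hterm (i + 1) i.succ_ne_zero)
  have hrest : (q.coeff 0 - LaurentPolynomial.C ((q.coeff 0).coeff d) * LaurentPolynomial.T d) • v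
      ∈ S := by
    refine laurent_smul_mem S v _ fun m hm => ?_
    rw [← LaurentPolynomial.single_eq_C_mul_T, AddMonoidAlgebra.coeff_sub, Finsupp.sub_apply,
      AddMonoidAlgebra.coeff_single] at hm
    by_cases hmd : m = d
    · simp [hmd] at hm
    · rw [Finsupp.single_eq_of_ne hmd, sub_zero] at hm
      exact h 0 m hm (Or.inr hmd)
  have hlead := S.sub_mem h0 hrest
  rw [← sub_smul, sub_sub_cancel, ← LaurentPolynomial.smul_eq_C_mul, smul_assoc] at hlead
  exact (S.smul_mem_iff hd).mp hlead

/-- If the characteristic polynomial has constant coefficients at both ends, then an invariant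
subspace containing sufficiently many consecutive shifts `T ^ j v` of a vector contains them
all: Cayley–Hamilton yields each further shift from the preceding ones. -/
theorem exists_window_T_smul_mem {A : Matrix ι ι K[T;T⁻¹]} (h₁ : HasConstTop A.charpoly)
    (h₂ : HasConstTop (A.charpoly.map (LaurentPolynomial.invert : K[T;T⁻¹] ≃ₐ[K] _).toRingHom)) :
    ∃ N : ℕ, ∀ S : Submodule K (ι → K[T;T⁻¹]), (∀ v ∈ S, matrixEnd A v ∈ S) →
      ∀ v, (∀ j : ℤ, j.natAbs ≤ N → (LaurentPolynomial.T j : K[T;T⁻¹]) • v ∈ S) →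
        ∀ j : ℤ, (LaurentPolynomial.T j : K[T;T⁻¹]) • v ∈ S := by
  obtain ⟨d, hd, hd'⟩ := h₁
  obtain ⟨e, he, he'⟩ := h₂
  have hinv (i : ℕ) (m : ℤ) :
      ((A.charpoly.map (LaurentPolynomial.invert : K[T;T⁻¹] ≃ₐ[K] _).toRingHom).coeff i).coeff m =
        (A.charpoly.coeff i).coeff (-m) := by
    rw [coeff_map]
    exact LaurentPolynomial.invert_apply _ _
  rw [hinv] at he
  have hle (i : ℕ) (m : ℤ) (hm : (A.charpoly.coeff i).coeff m ≠ 0) :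
      m ≤ d ∧ (m = d → i = 0) ∧ -e ≤ m ∧ (m = -e → i = 0) := by
    refine ⟨?_, ?_, ?_, ?_⟩
    · by_contra hlt
      exact hm (hd' i m (by lia) (Or.inr (by lia)))
    · intro h
      by_contra hi
      exact hm (hd' i m h.ge (Or.inl hi))
    · by_contra hlt
      refine hm ?_
      rw [← neg_neg m, ← hinv]
      exact he' i (-m) (by lia) (Or.inr (by lia))
    · intro h
      by_contra hi
      refine hm ?_
      rw [← neg_neg m, ← hinv]
      exact he' i (-m) (by lia) (Or.inl hi)
  -- The exponents of `T` in the characteristic polynomial range over `[-e, d]`.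
  refine ⟨(d + e).toNat, fun S hS v hv => ?_⟩
  have hshift (a b : ℤ) (w : ι → K[T;T⁻¹]) : (LaurentPolynomial.T a : K[T;T⁻¹]) •
      (LaurentPolynomial.T b : K[T;T⁻¹]) • w = (LaurentPolynomial.T (a + b) : K[T;T⁻¹]) • w := by
    rw [smul_smul, LaurentPolynomial.T_add]
  have key (k : ℕ) (j : ℤ) (hj : j.natAbs ≤ (d + e).toNat + k) :
      (LaurentPolynomial.T j : K[T;T⁻¹]) • v ∈ S := by
    induction k generalizing j with
    | zero => exact hv j hj
    | succ k ih =>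
      rcases Nat.lt_or_ge ((d + e).toNat + k) j.natAbs with hlt | hge
      · rcases lt_or_ge 0 j with hpos | hneg
        · have := T_smul_mem_of_aeval_eq_zero A.aeval_self_charpoly hS hd
            ((LaurentPolynomial.T (j - d) : K[T;T⁻¹]) • v) fun i m hm hne => by
              rw [hshift]
              have := hle i m hm
              exact ih _ (by grind)
          rwa [hshift, add_sub_cancel] at this
        · have := T_smul_mem_of_aeval_eq_zero A.aeval_self_charpoly hS he
            ((LaurentPolynomial.T (j - -e) : K[T;T⁻¹]) • v) fun i m hm hne => by
              rw [hshift]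
              have := hle i m hm
              exact ih _ (by grind)
          rwa [hshift, add_sub_cancel] at this
      · exact ih j hge
  exact fun j => key j.natAbs j (by lia)

end LaurentVectors

/-! ### Positive expansivity of a linear cellular automaton -/

theorem half_pow_le_tychonoffDist_iff {S : Type*} {c c' : ℤ → S} (N : ℕ) :
    (1 / 2 : ℝ) ^ N ≤ tychonoffDist c c' ↔ ∃ j : ℤ, j.natAbs ≤ N ∧ c j ≠ c' j := by
  classical
  rw [tychonoffDist]
  split_ifs with h
  · subst h
    simp
  · rw [pow_le_pow_iff_right_of_lt_one₀ (by norm_num) (by norm_num)]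
    obtain ⟨i, hi⟩ := Function.ne_iff.mp h
    constructor
    · intro hle
      obtain ⟨j, hj, hne⟩ := Nat.sInf_mem
        (s := {k : ℕ | ∃ j : ℤ, j.natAbs = k ∧ c j ≠ c' j}) ⟨_, i, rfl, hi⟩
      exact ⟨j, hj.trans_le hle, hne⟩
    · rintro ⟨j, hj, hne⟩
      have hmem : j.natAbs ∈ {k : ℕ | ∃ j : ℤ, j.natAbs = k ∧ c j ≠ c' j} := ⟨j, rfl, hne⟩
      exact (Nat.sInf_le hmem).trans hj

/-- In terms of the metric, the expansivity constant may be taken to be a power of `1 / 2`. -/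
theorem positivelyExpansive_iff {S : Type*} {F : (ℤ → S) → (ℤ → S)} :
    PositivelyExpansive F ↔ ∃ N : ℕ, ∀ c c' : ℤ → S, c ≠ c' →
      ∃ (l : ℕ) (j : ℤ), j.natAbs ≤ N ∧ F^[l] c j ≠ F^[l] c' j := by
  constructor
  · rintro ⟨ε, hε, h⟩
    obtain ⟨N, hN⟩ := exists_pow_lt_of_lt_one hε (by norm_num : (1 / 2 : ℝ) < 1)
    refine ⟨N, fun c c' hc => ?_⟩
    obtain ⟨l, hl⟩ := h c c' hc
    exact ⟨l, (half_pow_le_tychonoffDist_iff N).mp (hN.le.trans hl)⟩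
  · rintro ⟨N, h⟩
    refine ⟨(1 / 2) ^ N, by positivity, fun c c' hc => ?_⟩
    obtain ⟨l, hl⟩ := h c c' hc
    exact ⟨l, (half_pow_le_tychonoffDist_iff N).mpr hl⟩

namespace LinearCA

variable {m n : ℕ}

theorem toFun_apply (F : LinearCA m n) (c : ℤ → Fin n → ZMod m) (i : ℤ) (a : Fin n) :
    F.toFun c i a = ∑ j, ∑ b, F.coeff j a b * c (i + j) b := by
  simp [toFun, globalRule, localRule, Matrix.mulVec, dotProduct]

theorem toFun_sub (F : LinearCA m n) (c c' : ℤ → Fin n → ZMod m) :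
    F.toFun (c - c') = F.toFun c - F.toFun c' := by
  ext i a
  simp [toFun_apply, mul_sub]

theorem iterate_toFun_sub (F : LinearCA m n) (l : ℕ) (c c' : ℤ → Fin n → ZMod m) :
    F.toFun^[l] (c - c') = F.toFun^[l] c - F.toFun^[l] c' :=
  Function.Semiconj₂.iterate (op := fun x y => x - y) F.toFun_sub l c c'

theorem iterate_toFun_zero (F : LinearCA m n) (l : ℕ) : F.toFun^[l] 0 = 0 := by
  simpa using F.iterate_toFun_sub l 0 0

theorem iterate_toFun_nsmul (F : LinearCA m n) (l s : ℕ) (c : ℤ → Fin n → ZMod m) :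
    F.toFun^[l] (s • c) = s • F.toFun^[l] c := by
  have h : Function.Semiconj (fun c : ℤ → Fin n → ZMod m => s • c) F.toFun F.toFun := fun c => by
    ext i a
    simp [toFun_apply, Finset.mul_sum, mul_left_comm]
  exact ((h.iterate_right l).eq c).symm

theorem positivelyExpansive_toFun_iff (F : LinearCA m n) :
    PositivelyExpansive F.toFun ↔ ∃ N : ℕ, ∀ c : ℤ → Fin n → ZMod m, c ≠ 0 →
      ∃ (l : ℕ) (j : ℤ), j.natAbs ≤ N ∧ F.toFun^[l] c j ≠ 0 := by
  rw [positivelyExpansive_iff]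
  refine exists_congr fun N => ⟨fun h c hc => ?_, fun h c c' hc => ?_⟩
  · simpa [iterate_toFun_zero] using h c 0 hc
  · obtain ⟨l, j, hj, hne⟩ := h (c - c') (sub_ne_zero.mpr hc)
    refine ⟨l, j, hj, fun heq => hne ?_⟩
    rw [iterate_toFun_sub, Pi.sub_apply, heq, sub_self]

end LinearCA

/-! ### Reduction modulo `p` -/

section Reduction

variable {p k : ℕ}

/-- The embedding `ℤ/pℤ → ℤ/p^kℤ` induced by multiplication by `p ^ (k - 1)`. -/
noncomputable def embedPow (p : ℕ) {k : ℕ} (hk : k ≠ 0) : ZMod p →+ ZMod (p ^ k) :=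
  ZMod.lift p ⟨zmultiplesHom _ ((p : ZMod (p ^ k)) ^ (k - 1)), by
    have h : (p : ZMod (p ^ k)) ^ (k - 1) * p = 0 := by
      rw [← pow_succ, Nat.sub_add_cancel (Nat.one_le_iff_ne_zero.mpr hk)]
      exact_mod_cast ZMod.natCast_self (p ^ k)
    simpa [mul_comm] using h⟩

theorem embedPow_intCast (hk : k ≠ 0) (z : ℤ) :
    embedPow p hk (z : ZMod p) = z * (p : ZMod (p ^ k)) ^ (k - 1) := by
  simp [embedPow]

theorem embedPow_injective (hp : p ≠ 0) (hk : k ≠ 0) : Function.Injective (embedPow p hk) := by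
  rw [injective_iff_map_eq_zero]
  intro x hx
  obtain ⟨z, rfl⟩ := ZMod.intCast_surjective x
  rw [embedPow_intCast] at hx
  have h : ((z * p ^ (k - 1) : ℤ) : ZMod (p ^ k)) = 0 := by exact_mod_cast hx
  rw [ZMod.intCast_zmod_eq_zero_iff_dvd] at h ⊢
  rw [show ((p ^ k : ℕ) : ℤ) = p * (p : ℤ) ^ (k - 1) by
    rw [← pow_succ', Nat.sub_add_cancel (Nat.one_le_iff_ne_zero.mpr hk), Nat.cast_pow]] at h
  exact Int.dvd_of_mul_dvd_mul_right (pow_ne_zero _ (by exact_mod_cast hp)) h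

theorem exists_embedPow_eq (hp : p ≠ 0) (hk : k ≠ 0) {x : ZMod (p ^ k)}
    (hx : (p : ZMod (p ^ k)) * x = 0) : ∃ y, embedPow p hk y = x := by
  obtain ⟨z, rfl⟩ := ZMod.intCast_surjective x
  have h : ((p * z : ℤ) : ZMod (p ^ k)) = 0 := by exact_mod_cast hx
  rw [ZMod.intCast_zmod_eq_zero_iff_dvd] at h
  rw [show ((p ^ k : ℕ) : ℤ) = p * (p : ℤ) ^ (k - 1) by
    rw [← pow_succ', Nat.sub_add_cancel (Nat.one_le_iff_ne_zero.mpr hk), Nat.cast_pow]] at h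
  obtain ⟨w, rfl⟩ := Int.dvd_of_mul_dvd_mul_left (by exact_mod_cast hp) h
  exact ⟨w, by rw [embedPow_intCast]; push_cast; ring⟩

theorem embedPow_castHom_mul (hk : k ≠ 0) (r : ZMod (p ^ k)) (x : ZMod p) :
    embedPow p hk (ZMod.castHom (dvd_pow_self p hk) (ZMod p) r * x) = r * embedPow p hk x := by
  obtain ⟨z, rfl⟩ := ZMod.intCast_surjective r
  obtain ⟨w, rfl⟩ := ZMod.intCast_surjective x
  rw [map_intCast, ← Int.cast_mul, embedPow_intCast, embedPow_intCast]
  push_cast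
  ring

namespace LinearCA

variable {n : ℕ}

theorem iterate_toFun_embedPow (hk : k ≠ 0) (G : LinearCA (p ^ k) n) (l : ℕ)
    (c : ℤ → Fin n → ZMod p) (i : ℤ) (a : Fin n) :
    G.toFun^[l] (fun i a => embedPow p hk (c i a)) i a =
      embedPow p hk ((G.reduce (dvd_pow_self p hk)).toFun^[l] c i a) := by
  have h : Function.Semiconj (fun (c : ℤ → Fin n → ZMod p) i a => embedPow p hk (c i a))
      (G.reduce (dvd_pow_self p hk)).toFun G.toFun := fun c => by
    ext i a
    simp only [toFun_apply, map_sum, reduce, Matrix.map_apply, embedPow_castHom_mul]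
  exact (congrFun (congrFun ((h.iterate_right l).eq c) i) a).symm

/-- The configurations killed by `p` form a copy of the configurations over `ℤ/pℤ`, on which `G`
acts as its reduction; every nonzero configuration has a nonzero multiple of this form. -/
theorem positivelyExpansive_reduce_iff (hp : p ≠ 0) (hk : k ≠ 0) (G : LinearCA (p ^ k) n) :
    PositivelyExpansive G.toFun ↔
      PositivelyExpansive (G.reduce (dvd_pow_self p hk)).toFun := by
  have hinj := embedPow_injective hp hk
  have hzero (v : Fin n → ZMod p) : (fun a => embedPow p hk (v a)) = 0 ↔ v = 0 := by
    simp only [funext_iff, Pi.zero_apply, map_eq_zero_iff _ hinj]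
  rw [positivelyExpansive_toFun_iff, positivelyExpansive_toFun_iff]
  refine exists_congr fun N => ⟨fun h c hc => ?_, fun h c hc => ?_⟩
  · obtain ⟨l, j, hj, hne⟩ := h (fun i a => embedPow p hk (c i a)) fun h0 =>
      hc (funext fun i => (hzero _).mp (congrFun h0 i))
    refine ⟨l, j, hj, fun h0 => hne ?_⟩
    ext a
    rw [iterate_toFun_embedPow, h0]
    simp
  · -- Multiply `c` by the largest power of `p` that does not kill it.
    have hex : ∃ s : ℕ, (p ^ s) • c = 0 := ⟨k, by ext i a; simp⟩
    classical
    obtain ⟨s, hs⟩ : ∃ s, Nat.find hex = s + 1 := Nat.exists_eq_succ_of_ne_zero fun h0 => hc <| by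
      have := Nat.find_spec hex
      rwa [h0, pow_zero, one_smul] at this
    have hs0 : (p ^ s) • c ≠ 0 := Nat.find_min hex (by lia)
    have hs1 : p • (p ^ s) • c = 0 := by
      have := Nat.find_spec hex
      rwa [hs, pow_succ', mul_smul] at this
    have hlift (i : ℤ) (a : Fin n) : ∃ y, embedPow p hk y = ((p ^ s) • c) i a :=
      exists_embedPow_eq hp hk (by simpa using congrFun (congrFun hs1 i) a)
    choose c' hc' using hlift
    have hcc : (p ^ s) • c = fun i a => embedPow p hk (c' i a) := by
      ext i a
      exact (hc' i a).symm
    obtain ⟨l, j, hj, hne⟩ := h c' fun h0 => hs0 (by rw [hcc, h0]; ext i a; simp)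
    refine ⟨l, j, hj, fun h0 => hne ((hzero _).mp ?_)⟩
    ext a
    rw [← iterate_toFun_embedPow, ← hcc, iterate_toFun_nsmul, Pi.smul_apply, h0]
    simp

end LinearCA

end Reduction

/-! ### Configurations as linear forms -/

section Duality

variable {p n : ℕ} [Fact p.Prime]

/-- The configuration attached to a linear form `g` on the vectors of Laurent polynomials: its
`a`-th component at the position `i` is the value of `g` at `T ^ (-i)` times the `a`-th standard
basis vector. -/
noncomputable def configOf (g : (Fin n → (ZMod p)[T;T⁻¹]) →ₗ[ZMod p] ZMod p) :
    ℤ → Fin n → ZMod p :=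
  fun i a => g ((LaurentPolynomial.T (-i) : (ZMod p)[T;T⁻¹]) • Pi.single a 1)

theorem configOf_injective : Function.Injective (configOf (p := p) (n := n)) := by
  intro g g' h
  refine LinearMap.pi_ext' fun a => ?_
  ext i
  have := congrFun (congrFun h (-i)) a
  simp only [configOf, neg_neg, ← Pi.single_smul, smul_eq_mul, mul_one] at this
  exact this

theorem configOf_surjective : Function.Surjective (configOf (p := p) (n := n)) := by
  intro c
  refine ⟨∑ a, Finsupp.linearCombination (ZMod p) (fun i => c (-i) a) ∘ₗ
    (AddMonoidAlgebra.coeffLinearEquiv (ZMod p)).toLinearMap ∘ₗ LinearMap.proj a, ?_⟩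
  ext i a
  rw [configOf, LinearMap.sum_apply, Finset.sum_eq_single a]
  · simp only [LaurentPolynomial.T, LinearMap.comp_apply, LinearMap.proj_apply, Pi.smul_apply,
      Pi.single_eq_same, smul_eq_mul, mul_one, LinearEquiv.coe_coe]
    exact (Finsupp.linearCombination_single _ _ _).trans (by rw [one_smul, neg_neg])
  · intro b _ hb
    simp [Pi.single_eq_of_ne hb]
  · simp

/-- On configurations viewed as linear forms, a linear cellular automaton is the dual of the
transpose of its matrix. -/
theorem toFun_configOf (F : LinearCA p n)
    (g : (Fin n → (ZMod p)[T;T⁻¹]) →ₗ[ZMod p] ZMod p) :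
    F.toFun (configOf g) = configOf (g ∘ₗ matrixEnd F.matrix.transpose) := by
  ext i a
  have h : matrixEnd F.matrix.transpose
      ((LaurentPolynomial.T (-i) : (ZMod p)[T;T⁻¹]) • Pi.single a 1) =
      ∑ j, ∑ b, F.coeff j a b •
        (LaurentPolynomial.T (-(i + j)) : (ZMod p)[T;T⁻¹]) • Pi.single b 1 := by
    ext1 b
    rw [matrixEnd_apply, Matrix.mulVec_smul, Matrix.mulVec_single_one]
    simp only [LinearCA.matrix, Pi.smul_apply, Matrix.col_apply, Matrix.transpose_apply,
      Matrix.sum_apply, Matrix.map_apply, Finset.sum_apply, smul_eq_mul, Finset.mul_sum]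
    refine Finset.sum_congr rfl fun j _ => ?_
    rw [Finset.sum_eq_single b (fun b' _ hb' => by simp [Pi.single_eq_of_ne' hb']) (by simp),
      Pi.single_eq_same, mul_one, LaurentPolynomial.smul_eq_C_mul, neg_add,
      LaurentPolynomial.T_add, mul_left_comm]
  rw [LinearCA.toFun_apply, configOf, LinearMap.comp_apply, h]
  simp only [map_sum, map_smul, smul_eq_mul, configOf]

theorem iterate_toFun_configOf (F : LinearCA p n) (l : ℕ)
    (g : (Fin n → (ZMod p)[T;T⁻¹]) →ₗ[ZMod p] ZMod p) :
    F.toFun^[l] (configOf g) = configOf (g ∘ₗ matrixEnd F.matrix.transpose ^ l) := by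
  induction l generalizing g with
  | zero => rfl
  | succ l ih =>
    rw [Function.iterate_succ_apply, toFun_configOf, ih, LinearMap.comp_assoc, pow_succ']
    rfl

/-- A window detecting all configurations generates the vectors of Laurent polynomials over
`K[t]`, since otherwise a nonzero linear form vanishes on the submodule it generates. -/
theorem finite_of_positivelyExpansive {F : LinearCA p n} (hF : PositivelyExpansive F.toFun) :
    Module.Finite (ZMod p)[X] (Module.AEval' (matrixEnd F.matrix.transpose)) := by
  obtain ⟨N, hN⟩ := F.positivelyExpansive_toFun_iff.mp hF
  set φ := matrixEnd F.matrix.transpose with hφ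
  let e : Set.Icc (-(N : ℤ)) N × Fin n → Module.AEval' φ := fun x =>
    Module.AEval'.of φ ((LaurentPolynomial.T (-x.1.1) : (ZMod p)[T;T⁻¹]) • Pi.single x.2 1)
  have hspan : Submodule.span (ZMod p)[X] (Set.range e) = ⊤ := by
    by_contra hne
    obtain ⟨g, hg0, hg⟩ := Submodule.exists_le_ker_of_lt_top
      ((Submodule.span (ZMod p)[X] (Set.range e)).restrictScalars (ZMod p))
      (lt_top_iff_ne_top.mpr fun h => hne (by simpa using h))
    obtain ⟨l, j, hj, h⟩ := hN (configOf (g ∘ₗ (Module.AEval'.of φ).toLinearMap)) fun h0 => by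
      have h1 : g ∘ₗ (Module.AEval'.of φ).toLinearMap = 0 :=
        configOf_injective (h0.trans (by ext i a; simp [configOf]))
      exact hg0 (LinearMap.ext fun v => LinearMap.congr_fun h1 ((Module.AEval'.of φ).symm v))
    refine h ?_
    ext a
    rw [iterate_toFun_configOf]
    have hmem := Submodule.smul_mem _ (X ^ l : (ZMod p)[X])
      (Submodule.subset_span (R := (ZMod p)[X]) (Set.mem_range_self (f := e) (⟨j, by grind⟩, a)))
    have := hg hmem
    rw [LinearMap.mem_ker, Module.AEval'.X_pow_smul_of] at this
    exact this
  exact ⟨Submodule.fg_def.mpr ⟨_, Set.finite_range e, hspan⟩⟩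

theorem positivelyExpansive_of_hasConstTop {F : LinearCA p n}
    (h₁ : HasConstTop F.matrix.transpose.charpoly)
    (h₂ : HasConstTop (F.matrix.transpose.charpoly.map
      (LaurentPolynomial.invert : (ZMod p)[T;T⁻¹] ≃ₐ[ZMod p] _).toRingHom)) :
    PositivelyExpansive F.toFun := by
  obtain ⟨N, hN⟩ := exists_window_T_smul_mem h₁ h₂
  refine F.positivelyExpansive_toFun_iff.mpr ⟨N, fun c hc => ?_⟩
  by_contra! hzero
  obtain ⟨g, rfl⟩ := configOf_surjective c
  simp only [iterate_toFun_configOf] at hzero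
  refine hc ?_
  -- The largest invariant subspace of the kernel of `g`.
  let S : Submodule (ZMod p) (Fin n → (ZMod p)[T;T⁻¹]) :=
    ⨅ l : ℕ, LinearMap.ker (g ∘ₗ matrixEnd F.matrix.transpose ^ l)
  have hS : ∀ v ∈ S, matrixEnd F.matrix.transpose v ∈ S := by
    intro v hv
    simp only [S, Submodule.mem_iInf, LinearMap.mem_ker] at hv ⊢
    intro l
    have := hv (l + 1)
    rwa [pow_succ] at this
  ext i a
  have := hN S hS (Pi.single a 1) (fun j hj => ?_) (-i)
  · exact LinearMap.mem_ker.mp ((Submodule.mem_iInf _).mp this 0)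
  · simp only [S, Submodule.mem_iInf, LinearMap.mem_ker]
    intro l
    have := congrFun (hzero l (-j) (by simpa using hj)) a
    rw [configOf, neg_neg] at this
    exact this

theorem positivelyExpansive_iff_expansiveMatrix (hn : n ≠ 0) (F : LinearCA p n) :
    PositivelyExpansive F.toFun ↔ ExpansiveMatrix F.matrix := by
  rw [ExpansiveMatrix, expansivePolynomial_iff (Matrix.charpoly_monic _) (by simpa using hn),
    ← Matrix.charpoly_transpose]
  refine ⟨fun h => ?_, fun h => positivelyExpansive_of_hasConstTop h.1 h.2⟩
  have := finite_of_positivelyExpansive h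
  exact hasConstTop_charpoly_of_finite _

end Duality

end LCA

theorem mainTheorem4 (p k n : ℕ) (hp : p.Prime) (hk : 1 < k) (hn : 1 < n)
    (G : LCA.LinearCA (p ^ k) n)
    (A : Matrix (Fin n) (Fin n) (LaurentPolynomial (ZMod p)))
    (hA : A = LCA.reduceMatrix (dvd_pow_self p (Nat.ne_zero_of_lt hk)) G.matrix) :
    (∀ F : LCA.LinearCA p n, F.matrix = A →
      (LCA.PositivelyExpansive G.toFun ↔ LCA.PositivelyExpansive F.toFun)) ∧
    (LCA.PositivelyExpansive G.toFun ↔ LCA.ExpansiveMatrix A) := by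
  have : Fact p.Prime := ⟨hp⟩
  have hn0 : n ≠ 0 := by lia
  have key : LCA.PositivelyExpansive G.toFun ↔ LCA.ExpansiveMatrix A := by
    rw [G.positivelyExpansive_reduce_iff hp.ne_zero (Nat.ne_zero_of_lt hk),
      LCA.positivelyExpansive_iff_expansiveMatrix hn0, LCA.LinearCA.matrix_reduce, hA]
  refine ⟨fun F hF => ?_, key⟩
  rw [key, LCA.positivelyExpansive_iff_expansiveMatrix hn0, hF]
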